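/- Let $N\ge 2$, let $\varphi:\mathbb{R}^N\times(0,\infty)\to\mathbb{R}$ be continuous and put $\Phi(x,t)=\int_0^{|t|}\varphi(x,s)s\,ds$ for $x\in\mathbb{R}^N$, $t\in\mathbb{R}$. Assume: 1. for each $x$, $\varphi(x,\cdot)$ is of class $C^1$ on $(0,\infty)$; 2. $\varphi(x,t)>0$ and $\partial_t(\varphi(x,t)t)>0$ for all $x\in\mathbb{R}^N$ and $t>0$; 3. there are $1<p<N<q<p^*:=\frac{Np}{N-p}$ such that $p\le\frac{\varphi(x,|t|)|t|^2}{\Phi(x,|t|)}\le q$ for all $x\in\mathbb{R}^N$ and $t\neq0$; 4. $\Phi$ is radial in $x$: $\Phi(x,t)=\Phi(y,t)$ whenever $|x|=|y|$ and $t>0$; write $\Phi(s,t)$ for the value of $\Phi(x,t)$ at $|x|=s$; 5. there is $\kappa\in(0,2^{-(N+1)})$ such that, for all $s>0$ and $t\in\mathbb{R}$, $\partial_s\Phi(s,t)$ exists and $|\partial_s\Phi(s,t)|\le\kappa\,\Phi(s,t)$. Let $L^\Phi(\mathbb{R}^N)$ be the set of measurable $u:\mathbb{R}^N\to\mathbb{R}$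 (up to equality a.e.) with $\int_{\mathbb{R}^N}\Phi(x,|u|/\tau)\,dx<\infty$ for some $\tau>0$, and let $W^{1,\Phi}(\mathbb{R}^N)$ be the set of $u\in L^\Phi(\mathbb{R}^N)$ having a weak gradient $\nabla u$ with $|\nabla u|\in L^\Phi(\mathbb{R}^N)$. Let $\Phi^{-1}(x,\cdot)$ denote the inverse function of the restriction of $\Phi(x,\cdot)$ to $[0,\infty)$. Then there is a constant $C>0$ such that for every radial $v\in W^{1,\Phi}(\mathbb{R}^N)$ (that is, $v$ is a.e. equal to a function of $|x|$) the function $\Phi(\cdot,|v|)+\Phi(\cdot,|\nabla v|)$ is integrable on $\mathbb{R}^N$ and $$ |v(x)|\le\Phi^{-1}\!\left(x,\frac{C}{|x|^{N-1}}\int_{\mathbb{R}^N}\big[\Phi(y,|v(y)|)+\Phi(y,|\nabla v(y)|)\big]\,dy\right)\quad\text{for a.e. }x\in\mathbb{R}^N . $$ -/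

import Mathlib

open MeasureTheory Set
open scoped ContDiff

namespace MusielakSobolev

/-- The generalized N-function `Φ(x, t) = ∫₀^{|t|} φ(x, s) s ds` generated by `φ`. -/
noncomputable def Phi {N : ℕ} (φ : EuclideanSpace ℝ (Fin N) → ℝ → ℝ)
    (x : EuclideanSpace ℝ (Fin N)) (t : ℝ) : ℝ :=
  ∫ s in (0 : ℝ)..|t|, φ x s * s

/-- The inverse function `Φ⁻¹(x, ·)` of the restriction of `Φ(x, ·)` to `[0, ∞)`. -/
noncomputable def PhiInv {N : ℕ} (φ : EuclideanSpace ℝ (Fin N) → ℝ → ℝ)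
    (x : EuclideanSpace ℝ (Fin N)) (y : ℝ) : ℝ :=
  Function.invFunOn (Phi φ x) (Ici 0) y

/-- The Musielak-Orlicz space `L^Φ(ℝ^N)`: (classes of) measurable `u` such that
`∫ Φ(x, |u| / τ) dx < ∞` for some `τ > 0`. -/
def MemLPhi {N : ℕ} (φ : EuclideanSpace ℝ (Fin N) → ℝ → ℝ)
    (u : EuclideanSpace ℝ (Fin N) → ℝ) : Prop :=
  AEMeasurable u ∧
    ∃ τ : ℝ, 0 < τ ∧ ∫⁻ x, ENNReal.ofReal (Phi φ x (|u x| / τ)) < ⊤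

/-- `g` is the weak (distributional) gradient of `u` on `ℝ^N`: both are locally integrable and
`∫ u ∂ᵢψ = -∫ gᵢ ψ` for every test function `ψ ∈ C_c^∞(ℝ^N)` and every `i`. -/
structure HasWeakGradient {N : ℕ} (u : EuclideanSpace ℝ (Fin N) → ℝ)
    (g : EuclideanSpace ℝ (Fin N) → EuclideanSpace ℝ (Fin N)) : Prop where
  locallyIntegrable : LocallyIntegrable u
  locallyIntegrable_grad : LocallyIntegrable g
  integral_eq : ∀ ψ : EuclideanSpace ℝ (Fin N) → ℝ, ContDiff ℝ ∞ ψ → HasCompactSupport ψ →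
    ∀ i : Fin N, ∫ x, u x * fderiv ℝ ψ x (EuclideanSpace.single i 1) = -∫ x, g x i * ψ x

/-- `u` belongs to the Musielak-Sobolev space `W^{1,Φ}(ℝ^N)`, with weak gradient `∇u = g`
(which is unique up to null sets): `u ∈ L^Φ` and `|∇u| ∈ L^Φ`. -/
structure MemW1Phi {N : ℕ} (φ : EuclideanSpace ℝ (Fin N) → ℝ → ℝ)
    (u : EuclideanSpace ℝ (Fin N) → ℝ)
    (g : EuclideanSpace ℝ (Fin N) → EuclideanSpace ℝ (Fin N)) : Prop where
  memLPhi : MemLPhi φ u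
  hasWeakGradient : HasWeakGradient u g
  memLPhi_grad : MemLPhi φ (fun x => ‖g x‖)

/-- A (class of) function(s) on `ℝ^N` is radial: it agrees almost everywhere with a function of
`|x|`. -/
def IsRadial {N : ℕ} (u : EuclideanSpace ℝ (Fin N) → ℝ) : Prop :=
  ∃ w : ℝ → ℝ, ∀ᵐ x, u x = w ‖x‖

end MusielakSobolev

namespace MusielakSobolev

/-! Fix x ≠ 0, put r = |x|, and let σ be the area of the unit sphere. On the shell K = {r ≤ |z| ≤ r
+ 1} the weight k(z) = 1/(σ|z|^(N-1)) is a probability density, because it cancels the Jacobian of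
polar coordinates. The radial profile w of v satisfies |w(r) - w(s)| ≤ D := ∫_K k|∇v| for a.e. r and
s in [r, r + 1] (`HasWeakGradient.exists_abs_profile_sub_le`), hence |v(x)| ≤ |v(z)| + D for a.e. z
in K.

Doubling gives Φ(x,|v(x)|) ≤ 2^q (Φ(x,|v(z)|) + Φ(x,D)), and Jensen's inequality bounds Φ(x,D) by
∫_K k Φ(x,|∇v|). Averaging over z against k, with k ≤ 1/(σ r^(N-1)) on K, leaves modulars whose
first variable is frozen at x. A Gronwall argument in the radial variable replaces Φ(x,·) by e^κ
Φ(z,·) on K (`Phi_le_exp_mul_Phi`). Inverting Φ(x,·) yields the claim with C = 2^q e^κ/σ.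

The oscillation bound comes from testing the weak gradient with the field η(|x|)|x|^(-N) x, whose
divergence is η'(|x|)/|x|^(N-1). Polar coordinates and Fubini turn this into a one-dimensional
identity, and du Bois-Reymond's lemma identifies w up to a constant
(`HasWeakGradient.profile_ae_eq`). -/

/-- `h` is the derivative of an N-function `H` on the half line which satisfies the
`Δ₂`-type condition `h(t) t ≤ q H(t)`. -/
structure IsNDensity (h : ℝ → ℝ) (q : ℝ) : Prop where
  continuousOn : ContinuousOn h (Ioi 0)
  monotoneOn : MonotoneOn h (Ioi 0)
  pos : ∀ t, 0 < t → 0 < h t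
  intervalIntegrable : ∀ t, 0 ≤ t → IntervalIntegrable h volume 0 t
  mul_le : ∀ t, 0 < t → h t * t ≤ q * ∫ s in (0 : ℝ)..t, h s

/-! ### Convexity and doubling of N-functions on the half line. -/

namespace IsNDensity

variable {h : ℝ → ℝ} {q : ℝ}

lemma intervalIntegrable_of_nonneg (H : IsNDensity h q) {a b : ℝ} (ha : 0 ≤ a) (hb : 0 ≤ b) :
    IntervalIntegrable h volume a b :=
  (H.intervalIntegrable a ha).symm.trans (H.intervalIntegrable b hb)

lemma integral_sub (H : IsNDensity h q) {a b : ℝ} (ha : 0 ≤ a) (hb : 0 ≤ b) :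
    (∫ s in (0 : ℝ)..b, h s) - ∫ s in (0 : ℝ)..a, h s = ∫ s in a..b, h s :=
  intervalIntegral.integral_interval_sub_left (H.intervalIntegrable b hb)
    (H.intervalIntegrable a ha)

/-- The primitive of a monotone density is convex and lies above its tangent at m. This supporting
line gives both surjectivity and Jensen's inequality. -/
lemma tangent_le (H : IsNDensity h q) {m b : ℝ} (hm : 0 < m) (hb : 0 ≤ b) :
    (∫ s in (0 : ℝ)..m, h s) + h m * (b - m) ≤ ∫ s in (0 : ℝ)..b, h s := by
  rcases le_total m b with hmb | hbm
  · have h1 : ∫ _ in m..b, h m ≤ ∫ s in m..b, h s :=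
      intervalIntegral.integral_mono_on hmb intervalIntegrable_const
        (H.intervalIntegrable_of_nonneg hm.le hb)
        fun s hs => H.monotoneOn hm (hm.trans_le hs.1) hs.1
    rw [← H.integral_sub hm.le hb, intervalIntegral.integral_const, smul_eq_mul] at h1
    linarith
  · have h1 : ∫ s in b..m, h s ≤ ∫ _ in b..m, h m :=
      intervalIntegral.integral_mono_on_of_le_Ioo hbm
        (H.intervalIntegrable_of_nonneg hb hm.le) intervalIntegrable_const
        fun s hs => H.monotoneOn (hb.trans_lt hs.1) hm hs.2.le
    rw [← H.integral_sub hb hm.le, intervalIntegral.integral_const, smul_eq_mul] at h1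
    linarith

lemma strictMonoOn (H : IsNDensity h q) :
    StrictMonoOn (fun t => ∫ s in (0 : ℝ)..t, h s) (Ici 0) := by
  intro a ha b hb hab
  have := intervalIntegral.intervalIntegral_pos_of_pos_on
    (H.intervalIntegrable_of_nonneg ha hb) (fun s hs => H.pos s (lt_of_le_of_lt ha hs.1)) hab
  rw [← H.integral_sub ha hb] at this
  exact sub_pos.1 this

lemma integral_nonneg (H : IsNDensity h q) {t : ℝ} (ht : 0 ≤ t) : 0 ≤ ∫ s in (0 : ℝ)..t, h s := by
  simpa using H.strictMonoOn.monotoneOn (mem_Ici.2 le_rfl) (mem_Ici.2 ht) ht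

lemma hasDerivAt (H : IsNDensity h q) {t : ℝ} (ht : 0 < t) :
    HasDerivAt (fun t => ∫ s in (0 : ℝ)..t, h s) (h t) t :=
  intervalIntegral.integral_hasDerivAt_right (H.intervalIntegrable t ht.le)
    (H.continuousOn.stronglyMeasurableAtFilter isOpen_Ioi t ht)
    (H.continuousOn.continuousAt (Ioi_mem_nhds ht))

lemma continuousOn_integral (H : IsNDensity h q) (b : ℝ) (hb : 0 ≤ b) :
    ContinuousOn (fun t => ∫ s in (0 : ℝ)..t, h s) (Icc 0 b) := by
  have := intervalIntegral.continuousOn_primitive_interval (μ := volume) (f := h) (a := 0) (b := b)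
    ((intervalIntegrable_iff' (by simp)).1 (H.intervalIntegrable b hb))
  rwa [uIcc_of_le hb] at this

lemma surjOn (H : IsNDensity h q) {y : ℝ} (hy : 0 ≤ y) :
    ∃ t, 0 ≤ t ∧ ∫ s in (0 : ℝ)..t, h s = y := by
  have h1 := H.pos 1 one_pos
  -- Chosen so that the tangent at 1 has risen by exactly y at b.
  set b := 1 + y / h 1
  have hb : 0 ≤ b := by positivity
  have hle : y ≤ ∫ s in (0 : ℝ)..b, h s := by
    have := H.tangent_le one_pos hb
    have h2 := H.integral_nonneg zero_le_one
    have h3 : h 1 * (b - 1) = y := by simp only [b]; field_simp; ring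
    linarith
  obtain ⟨t, ht, rfl⟩ := intermediate_value_Icc hb (H.continuousOn_integral b hb)
    ⟨by simpa using hy, hle⟩
  exact ⟨t, ht.1, rfl⟩

/-- Writing H for the primitive, h(t) t ≤ q H(t) says that t^(-q) H(t) has nonpositive derivative;
compare its values at t and l t. -/
lemma integral_mul_le (H : IsNDensity h q) {l t : ℝ} (hl : 1 ≤ l) (ht : 0 ≤ t) :
    ∫ s in (0 : ℝ)..(l * t), h s ≤ l ^ q * ∫ s in (0 : ℝ)..t, h s := by
  rcases ht.eq_or_lt with rfl | ht
  · simp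
  have key : AntitoneOn (fun t => t ^ (-q) * ∫ s in (0 : ℝ)..t, h s) (Ioi 0) := by
    have hd : ∀ t ∈ Ioi (0 : ℝ), HasDerivAt (fun t => t ^ (-q) * ∫ s in (0 : ℝ)..t, h s)
        (-q * t ^ (-q - 1) * (∫ s in (0 : ℝ)..t, h s) + t ^ (-q) * h t) t := fun t ht =>
      (Real.hasDerivAt_rpow_const (Or.inl (ne_of_gt ht))).mul (H.hasDerivAt ht)
    refine antitoneOn_of_deriv_nonpos (convex_Ioi 0)
      (fun t ht => (hd t ht).continuousAt.continuousWithinAt) ?_ ?_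
    · rw [interior_Ioi]
      exact fun t ht => (hd t ht).differentiableAt.differentiableWithinAt
    · rw [interior_Ioi]
      intro t ht
      rw [(hd t ht).deriv]
      have h1 := H.mul_le t ht
      have h2 : t ^ (-q) = t ^ (-q - 1) * t := by
        rw [Real.rpow_sub_one (ne_of_gt ht), div_mul_cancel₀ _ (ne_of_gt ht)]
      have h3 : 0 < t ^ (-q - 1) := Real.rpow_pos_of_pos ht _
      rw [h2]
      nlinarith
  have hl0 : 0 < l := by linarith
  have h1 := key ht (mul_pos hl0 ht) (le_mul_of_one_le_left ht.le hl)
  simp only [Real.mul_rpow hl0.le ht.le, Real.rpow_neg hl0.le] at h1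
  have h2 : 0 < t ^ (-q) := Real.rpow_pos_of_pos ht _
  have h3 : 0 < l ^ q := Real.rpow_pos_of_pos hl0 _
  rw [mul_comm (l ^ q)⁻¹, mul_assoc] at h1
  have h4 := le_of_mul_le_mul_left h1 h2
  rwa [inv_mul_le_iff₀ h3] at h4

lemma integral_add_le (H : IsNDensity h q) {a b : ℝ} (ha : 0 ≤ a) (hb : 0 ≤ b) :
    ∫ s in (0 : ℝ)..(a + b), h s ≤
      2 ^ q * ((∫ s in (0 : ℝ)..a, h s) + ∫ s in (0 : ℝ)..b, h s) := by
  wlog hab : a ≤ b generalizing a b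
  · rw [add_comm a, add_comm (∫ s in (0 : ℝ)..a, h s)]
    exact this hb ha (le_of_not_ge hab)
  have h2 : (0 : ℝ) ≤ 2 ^ q := by positivity
  calc ∫ s in (0 : ℝ)..(a + b), h s ≤ ∫ s in (0 : ℝ)..(2 * b), h s :=
        H.strictMonoOn.monotoneOn (mem_Ici.2 (by positivity)) (mem_Ici.2 (by positivity))
          (by linarith)
    _ ≤ 2 ^ q * ∫ s in (0 : ℝ)..b, h s := H.integral_mul_le one_le_two hb
    _ ≤ _ := mul_le_mul_of_nonneg_left (by linarith [H.integral_nonneg ha]) h2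

end IsNDensity

/-- The fundamental lemma of du Bois-Reymond on a half line. -/
theorem ae_eq_const_of_integral_deriv_mul_eq_zero {a : ℝ} {f : ℝ → ℝ}
    (hf : LocallyIntegrableOn f (Ioi a))
    (h : ∀ η : ℝ → ℝ, ContDiff ℝ ∞ η → HasCompactSupport η → tsupport η ⊆ Ioi a →
      ∫ x, deriv η x * f x = 0) :
    ∃ c, ∀ᵐ x, x ∈ Ioi a → f x = c := by
  -- A bump of mass one supported inside (a, ∞); the constant will be the mean of f against it.
  let B : ContDiffBump (a + 1) := ⟨1 / 4, 1 / 2, by norm_num, by norm_num⟩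
  set ρ := B.normed volume with hρ
  have hρs : ContDiff ℝ ∞ ρ := B.contDiff_normed
  have hρc : HasCompactSupport ρ := B.hasCompactSupport_normed
  have hρt : tsupport ρ ⊆ Ioi a := by
    rw [hρ, B.tsupport_normed_eq, Real.closedBall_eq_Icc]
    intro x hx
    have := hx.1
    simp only [mem_Ioi]
    norm_num [B] at this
    linarith
  have hρ1 : ∫ x, ρ x = 1 := B.integral_normed
  have hint : ∀ ζ : ℝ → ℝ, Continuous ζ → HasCompactSupport ζ → tsupport ζ ⊆ Ioi a →
      Integrable (fun x => ζ x * f x) := by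
    intro ζ hζ hζc hζt
    have h1 : IntegrableOn (fun x => ζ x * f x) (tsupport ζ) := by
      have := (hf.integrableOn_compact_subset hζt hζc)
      exact this.continuousOn_mul hζ.continuousOn hζc
    refine (integrableOn_iff_integrable_of_support_subset ?_).1 h1
    exact (Function.support_mul_subset_left _ _).trans (subset_tsupport _)
  refine ⟨∫ x, ρ x * f x, ?_⟩
  set c := ∫ x, ρ x * f x with hc
  have key := isOpen_Ioi.ae_eq_zero_of_integral_contDiff_smul_eq_zero (μ := volume)
    (f := fun x => f x - c) (U := Ioi a) (hf.sub (locallyIntegrableOn_const c)) ?_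
  · filter_upwards [key] with x hx hxa
    exact sub_eq_zero.1 (hx hxa)
  intro ζ hζ hζc hζt
  set I := ∫ x, ζ x with hI
  -- Subtracting I ρ makes the total integral zero, so the primitive of g has compact support and is
  -- an admissible test function.
  set g : ℝ → ℝ := fun x => ζ x - I * ρ x with hg
  have hgs : ContDiff ℝ ∞ g := hζ.sub (contDiff_const.mul hρs)
  have hK : IsCompact (tsupport ζ ∪ tsupport ρ) := hζc.isCompact.union hρc.isCompact
  have hKa : tsupport ζ ∪ tsupport ρ ⊆ Ioi a := union_subset hζt hρt
  have hKne : (tsupport ζ ∪ tsupport ρ).Nonempty := by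
    refine Nonempty.inr ?_
    rw [hρ, B.tsupport_normed_eq]
    exact ⟨a + 1, by simp [B]⟩
  obtain ⟨m, hm⟩ := hK.exists_isLeast hKne
  obtain ⟨M, hM⟩ := hK.exists_isGreatest hKne
  have hg0 : ∀ x, x ∉ tsupport ζ ∪ tsupport ρ → g x = 0 := by
    intro x hx
    have h1 := image_eq_zero_of_notMem_tsupport fun h => hx (Or.inl h)
    have h2 := image_eq_zero_of_notMem_tsupport fun h => hx (Or.inr h)
    simp [hg, h1, h2]
  have hζint : Integrable ζ := hζ.continuous.integrable_of_hasCompactSupport hζc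
  have hρint : Integrable ρ := hρs.continuous.integrable_of_hasCompactSupport hρc
  have hgint : Integrable g := hζint.sub (hρint.const_mul I)
  have hgtot : ∫ x, g x = 0 := by
    rw [hg, integral_sub hζint (hρint.const_mul I), integral_const_mul, hρ1]
    simp [hI]
  set η : ℝ → ℝ := fun x => ∫ s in a..x, g s with hη
  have hηd : ∀ x, HasDerivAt η (g x) x := fun x =>
    intervalIntegral.integral_hasDerivAt_right hgint.intervalIntegrable
      hgs.continuous.stronglyMeasurable.stronglyMeasurableAtFilter hgs.continuous.continuousAt
  have hderiv : deriv η = g := funext fun x => (hηd x).deriv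
  have hηs : ContDiff ℝ ∞ η := by
    rw [contDiff_infty_iff_deriv, hderiv]
    exact ⟨fun x => (hηd x).differentiableAt, hgs⟩
  have hη0 : ∀ x, x ∉ Icc m M → η x = 0 := by
    intro x hx
    rw [mem_Icc, not_and_or, not_le, not_le] at hx
    rcases hx with hx | hx
    · refine intervalIntegral.integral_zero_ae (Filter.Eventually.of_forall fun s hs => hg0 s ?_)
      intro hsK
      have h1 := hm.2 hsK
      have h2 : a < m := hKa hm.1
      have := hs.2
      rcases max_choice a x with h | h <;> rw [h] at this <;> linarith
    · have hax : a ≤ x := (hKa hM.1).le.trans hx.le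
      rw [hη]
      simp only
      rw [intervalIntegral.integral_of_le hax, setIntegral_eq_integral_of_forall_compl_eq_zero, hgtot]
      intro s hs
      refine hg0 s fun hsK => hs ⟨hKa hsK, (hM.2 hsK).trans hx.le⟩
  have hts : tsupport η ⊆ Icc m M :=
    closure_minimal (fun x hx => by by_contra hx'; exact hx (hη0 x hx')) isClosed_Icc
  have hηc : HasCompactSupport η := HasCompactSupport.of_support_subset_isCompact isCompact_Icc
    ((subset_tsupport _).trans hts)
  have := h η hηs hηc (hts.trans fun x hx => (hKa hm.1).trans_le hx.1)
  rw [hderiv] at this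
  have h1 := hint ζ hζ.continuous hζc hζt
  have h2 := hint ρ hρs.continuous hρc hρt
  have h3 : ∀ x, g x * f x = ζ x * f x - I * (ρ x * f x) := fun x => by simp only [hg]; ring
  simp only [h3] at this
  rw [MeasureTheory.integral_sub h1 (h2.const_mul I), integral_const_mul] at this
  simp only [smul_eq_mul, mul_sub]
  rw [MeasureTheory.integral_sub h1 (hζint.mul_const c), integral_mul_const]
  exact this

/-! ### Radial vector fields as test functions. -/

section RadialTest

variable {N : ℕ}

lemma hasFDerivAt_norm_of_ne_zero {x : EuclideanSpace ℝ (Fin N)} (hx : x ≠ 0) :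
    HasFDerivAt (fun y : EuclideanSpace ℝ (Fin N) => ‖y‖) (‖x‖⁻¹ • innerSL ℝ x) x := by
  have h1 := (hasStrictFDerivAt_norm_sq x).hasFDerivAt.sqrt (by simpa using hx)
  simp only [Real.sqrt_sq (norm_nonneg _)] at h1
  refine h1.congr_fderiv ?_
  ext y
  simp
  field_simp

/-- The components of the radial vector field `x ↦ η(|x|) |x|⁻ᴺ x`. -/
noncomputable def radialField (η : ℝ → ℝ) (i : Fin N) (x : EuclideanSpace ℝ (Fin N)) : ℝ :=
  η ‖x‖ / ‖x‖ ^ N * x i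

variable {η : ℝ → ℝ} {a : ℝ}

lemma eq_zero_of_tsupport_subset_Ioi (hη : tsupport η ⊆ Ioi a) {r : ℝ} (hr : r ≤ a) : η r = 0 :=
  image_eq_zero_of_notMem_tsupport fun h => not_lt.2 hr (hη h)

lemma deriv_eq_zero_of_tsupport_subset_Ioi (hη : tsupport η ⊆ Ioi a) {r : ℝ} (hr : r ≤ a) :
    deriv η r = 0 :=
  image_eq_zero_of_notMem_tsupport
    fun h => not_lt.2 hr (hη (tsupport_deriv_subset h))

lemma radialField_eventuallyEq_zero (ha : 0 < a) (hη : tsupport η ⊆ Ioi a) (i : Fin N) :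
    radialField η i =ᶠ[nhds 0] fun _ => 0 := by
  filter_upwards [Metric.ball_mem_nhds (0 : EuclideanSpace ℝ (Fin N)) ha] with x hx
  have : ‖x‖ ≤ a := by simpa using (mem_ball_zero_iff.1 hx).le
  simp [radialField, eq_zero_of_tsupport_subset_Ioi hη this]

/-- The singularity of |x|^(-N) is harmless because η vanishes on [0, a], so the field is zero near
the origin. -/
lemma contDiff_radialField (ha : 0 < a) (hη : tsupport η ⊆ Ioi a) (hs : ContDiff ℝ ∞ η)
    (i : Fin N) : ContDiff ℝ ∞ (radialField η i) := by
  rw [contDiff_iff_contDiffAt]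
  intro x
  rcases eq_or_ne x 0 with rfl | hx
  · exact contDiffAt_const.congr_of_eventuallyEq (radialField_eventuallyEq_zero ha hη i)
  · have h1 : ContDiffAt ℝ ∞ (fun y : EuclideanSpace ℝ (Fin N) => ‖y‖) x := contDiffAt_norm ℝ hx
    have h2 : ContDiffAt ℝ ∞ (fun y : EuclideanSpace ℝ (Fin N) => y i) x :=
      (EuclideanSpace.proj (𝕜 := ℝ) i).contDiff.contDiffAt
    exact ((hs.contDiffAt.comp x h1).div (h1.pow N) (pow_ne_zero _ (norm_ne_zero_iff.2 hx))).mul h2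

lemma hasCompactSupport_radialField (hη : HasCompactSupport η) (i : Fin N) :
    HasCompactSupport (radialField η i) := by
  obtain ⟨R, hR⟩ := hη.isCompact.isBounded.subset_closedBall 0
  refine HasCompactSupport.intro (isCompact_closedBall (0 : EuclideanSpace ℝ (Fin N)) R) ?_
  intro x hx
  have : η ‖x‖ = 0 := image_eq_zero_of_notMem_tsupport fun h => hx (by simpa using hR h)
  simp [radialField, this]

lemma fderiv_radialField (hs : ContDiff ℝ ∞ η) (i : Fin N) {x : EuclideanSpace ℝ (Fin N)}
    (hx : x ≠ 0) :
    fderiv ℝ (radialField η i) x (EuclideanSpace.single i 1) =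
      (deriv η ‖x‖ * ‖x‖ ^ N - η ‖x‖ * (N * ‖x‖ ^ (N - 1))) / (‖x‖ ^ N) ^ 2 * (x i ^ 2 / ‖x‖) +
        η ‖x‖ / ‖x‖ ^ N := by
  have hx' := norm_ne_zero_iff.2 hx
  have h0 : HasDerivAt (fun r : ℝ => η r / r ^ N) _ ‖x‖ :=
    ((hs.differentiable (by simp)) ‖x‖).hasDerivAt.div (hasDerivAt_pow N ‖x‖) (pow_ne_zero _ hx')
  have h1 := (h0.comp_hasFDerivAt x (hasFDerivAt_norm_of_ne_zero hx)).mul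
    (EuclideanSpace.proj (𝕜 := ℝ) i).hasFDerivAt
  have h2 : HasFDerivAt (radialField η i) _ x := h1
  rw [h2.fderiv]
  simp [EuclideanSpace.inner_single_right]
  ring

/-- The field |x|^(-N) x is divergence free away from the origin, so only the derivative of η
survives. -/
lemma sum_fderiv_radialField (hN : 2 ≤ N) (ha : 0 < a) (hη : tsupport η ⊆ Ioi a)
    (hs : ContDiff ℝ ∞ η) (x : EuclideanSpace ℝ (Fin N)) :
    ∑ i, fderiv ℝ (radialField η i) x (EuclideanSpace.single i 1) =
      deriv η ‖x‖ / ‖x‖ ^ (N - 1) := by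
  rcases eq_or_ne x 0 with rfl | hx
  · have h1 : ∀ i : Fin N, fderiv ℝ (radialField η i) 0 = 0 := fun i => by
      rw [(radialField_eventuallyEq_zero ha hη i).fderiv_eq]; simp
    simp [h1, deriv_eq_zero_of_tsupport_subset_Ioi hη ha.le]
  · have hx' := norm_ne_zero_iff.2 hx
    simp only [fderiv_radialField hs _ hx]
    rw [Finset.sum_add_distrib, ← Finset.mul_sum, ← Finset.sum_div,
      ← EuclideanSpace.real_norm_sq_eq]
    obtain ⟨n, rfl⟩ : ∃ n, N = n + 1 := ⟨N - 1, by omega⟩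
    simp only [Finset.sum_const, Finset.card_univ, Fintype.card_fin, nsmul_eq_mul,
      Nat.add_sub_cancel]
    field_simp
    ring

/-- Sum the weak identities for the components of the field. Only the radial part of g enters, so g
itself need not be radial. -/
theorem HasWeakGradient.integral_radial (hN : 2 ≤ N) {v : EuclideanSpace ℝ (Fin N) → ℝ}
    {g : EuclideanSpace ℝ (Fin N) → EuclideanSpace ℝ (Fin N)} (hv : HasWeakGradient v g)
    (ha : 0 < a) (hη : tsupport η ⊆ Ioi a) (hs : ContDiff ℝ ∞ η) (hc : HasCompactSupport η) :
    ∫ x, v x * (deriv η ‖x‖ / ‖x‖ ^ (N - 1)) =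
      -∫ x, inner ℝ (g x) x / ‖x‖ ^ N * η ‖x‖ := by
  have hψ := fun i : Fin N => contDiff_radialField ha hη hs i
  have hψc := fun i : Fin N => hasCompactSupport_radialField (N := N) hc i
  have h1 : ∀ i ∈ Finset.univ, Integrable fun x =>
      v x * fderiv ℝ (radialField η i) x (EuclideanSpace.single i 1) := by
    intro i _
    have := hv.locallyIntegrable.integrable_smul_left_of_hasCompactSupport
      (g := fun x => fderiv ℝ (radialField η i) x (EuclideanSpace.single i 1))
      (((hψ i).continuous_fderiv (by simp)).clm_apply continuous_const)
      ((hψc i).fderiv_apply ℝ _)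
    simpa [mul_comm] using this
  have h2 : ∀ i ∈ Finset.univ, Integrable fun x => g x i * radialField η i x := by
    intro i _
    have := (EuclideanSpace.proj (𝕜 := ℝ) i).integrable_comp
      (hv.locallyIntegrable_grad.integrable_smul_left_of_hasCompactSupport
      (hψ i).continuous (hψc i))
    simpa [mul_comm] using this
  have h3 := Finset.sum_congr rfl fun i (_ : i ∈ Finset.univ) =>
    hv.integral_eq _ (hψ i) (hψc i) i
  rw [← integral_finsetSum _ h1, Finset.sum_neg_distrib, ← integral_finsetSum _ h2] at h3
  simp only [← Finset.mul_sum, sum_fderiv_radialField hN ha hη hs] at h3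
  rw [h3]
  congr 2 with x
  rw [PiLp.inner_apply, Finset.sum_div, Finset.sum_mul]
  refine Finset.sum_congr rfl fun i _ => ?_
  simp [radialField]
  ring

end RadialTest

/-! ### Polar coordinates with the weight |x|^(1-N). -/

section Polar

variable {N : ℕ}

/-- The surface area of the unit sphere of `ℝᴺ`. -/
noncomputable def sphereArea (N : ℕ) : ℝ :=
  N * (volume : Measure (EuclideanSpace ℝ (Fin N))).real (Metric.ball 0 1)

lemma sphereArea_pos (hN : 2 ≤ N) : 0 < sphereArea N := by
  have : 0 < (volume : Measure (EuclideanSpace ℝ (Fin N))).real (Metric.ball 0 1) :=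
    ENNReal.toReal_pos (Metric.measure_ball_pos _ _ one_pos).ne' measure_ball_lt_top.ne
  unfold sphereArea
  positivity

lemma nontrivial_euclideanSpace (hN : 2 ≤ N) : Nontrivial (EuclideanSpace ℝ (Fin N)) := by
  have : Nonempty (Fin N) := ⟨⟨0, by omega⟩⟩
  infer_instance

lemma integral_norm_div_pow (hN : 2 ≤ N) (F : ℝ → ℝ) :
    ∫ x : EuclideanSpace ℝ (Fin N), F ‖x‖ / ‖x‖ ^ (N - 1) =
      sphereArea N * ∫ r in Ioi 0, F r := by
  have := nontrivial_euclideanSpace hN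
  rw [integral_fun_norm_addHaar volume (fun r => F r / r ^ (N - 1))]
  simp only [finrank_euclideanSpace, Fintype.card_fin, nsmul_eq_mul, smul_eq_mul]
  rw [sphereArea, ← mul_assoc]
  congr 1
  refine setIntegral_congr_fun measurableSet_Ioi fun r hr => ?_
  have : r ≠ 0 := ne_of_gt hr
  field_simp

lemma integrable_norm_div_pow (hN : 2 ≤ N) {F : ℝ → ℝ} :
    Integrable (fun x : EuclideanSpace ℝ (Fin N) => F ‖x‖ / ‖x‖ ^ (N - 1)) ↔
      IntegrableOn F (Ioi 0) := by
  have := nontrivial_euclideanSpace hN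
  rw [integrable_fun_norm_addHaar volume (f := fun r => F r / r ^ (N - 1))]
  simp only [finrank_euclideanSpace, Fintype.card_fin, smul_eq_mul]
  refine integrableOn_congr_fun (fun r hr => ?_) measurableSet_Ioi
  have : r ≠ 0 := ne_of_gt hr
  field_simp

/-- A property of almost every radius holds at the norm of almost every point. -/
lemma ae_norm_of_ae (hN : 2 ≤ N) {P : ℝ → Prop} (h : ∀ᵐ r, P r) :
    ∀ᵐ x : EuclideanSpace ℝ (Fin N), P ‖x‖ := by
  -- A measurable null set containing the bad radii; its indicator has zero integral in r, hence
  -- also after composition with the norm.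
  set T := toMeasurable volume {r | ¬ P r} with hT
  have hT0 : volume T = 0 := by rw [hT, measure_toMeasurable]; exact h
  have hTae : T.indicator (fun _ => (1 : ℝ)) =ᵐ[volume] 0 :=
    indicator_meas_zero hT0
  have h1 : IntegrableOn (T.indicator fun _ => (1 : ℝ)) (Ioi 0) :=
    ((integrable_zero ℝ ℝ volume).congr hTae.symm).integrableOn
  have h2 := (integrable_norm_div_pow hN).2 h1
  have h3 := integral_norm_div_pow hN (T.indicator fun _ => (1 : ℝ))
  rw [setIntegral_congr_ae (g := fun _ => 0) measurableSet_Ioi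
    (hTae.mono fun x hx _ => hx)] at h3
  simp only [integral_zero, mul_zero] at h3
  rw [integral_eq_zero_iff_of_nonneg
    (fun x => div_nonneg (indicator_nonneg (by simp) _) (by positivity)) h2] at h3
  have := nontrivial_euclideanSpace hN
  have hne : ∀ᵐ x : EuclideanSpace ℝ (Fin N), x ≠ 0 := by
    simp [ae_iff]
  filter_upwards [h3, hne] with x hx hx0
  by_contra hP
  have : ‖x‖ ∈ T := subset_toMeasurable _ _ hP
  simp [this, hx0] at hx

end Polar

/-! ### Integrals over shells and Fubini in the radius. -/

section Shell

variable {N : ℕ}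

/-- The open spherical shell `a < |x| < b`. -/
def shell (N : ℕ) (a b : ℝ) : Set (EuclideanSpace ℝ (Fin N)) := {x | a < ‖x‖ ∧ ‖x‖ < b}

/-- The closed spherical shell `a ≤ |x| ≤ b`. -/
def closedShell (N : ℕ) (a b : ℝ) : Set (EuclideanSpace ℝ (Fin N)) := {x | a ≤ ‖x‖ ∧ ‖x‖ ≤ b}

lemma measurableSet_closedShell (a b : ℝ) : MeasurableSet (closedShell N a b) :=
  (measurableSet_le measurable_const measurable_norm).inter
    (measurableSet_le measurable_norm measurable_const)

lemma measurableSet_shell (a b : ℝ) : MeasurableSet (shell N a b) :=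
  (measurableSet_lt measurable_const measurable_norm).inter
    (measurableSet_lt measurable_norm measurable_const)

lemma integrableOn_inv_norm_pow_smul {F : Type*} [NormedAddCommGroup F] [NormedSpace ℝ F]
    {V : EuclideanSpace ℝ (Fin N) → F} (hV : LocallyIntegrable V) {a : ℝ} (ha : 0 < a) (b : ℝ)
    (j : ℕ) : IntegrableOn (fun x => (‖x‖ ^ j)⁻¹ • V x) (closedShell N a b) := by
  have hK : IsCompact (closedShell N a b) := by
    have : closedShell N a b = {x | a ≤ ‖x‖} ∩ Metric.closedBall 0 b := by
      ext; simp [closedShell]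
    rw [this]
    exact (isCompact_closedBall _ _).inter_left (isClosed_le continuous_const continuous_norm)
  refine (hV.integrableOn_isCompact hK).continuousOn_smul (ContinuousOn.inv₀ (by fun_prop) ?_) hK
  exact fun x hx => pow_ne_zero _ (ha.trans_le hx.1).ne'

lemma shell_subset (a b : ℝ) : shell N a b ⊆ closedShell N a b :=
  fun _ hx => ⟨hx.1.le, hx.2.le⟩

lemma integrable_prod_indicator_shell {f : EuclideanSpace ℝ (Fin N) → ℝ} {a R : ℝ}
    (hf : IntegrableOn f (shell N a R)) {u : ℝ → ℝ} (hu : IntegrableOn u (Ioo a R)) :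
    Integrable (Function.uncurry fun (z : EuclideanSpace ℝ (Fin N)) (r : ℝ) =>
      f z * (Ioi ‖z‖).indicator u r)
      ((volume.restrict (shell N a R)).prod (volume.restrict (Ioo a R))) := by
  have h1 := Integrable.mul_prod hf hu
  have hm : MeasurableSet {p : EuclideanSpace ℝ (Fin N) × ℝ | ‖p.1‖ < p.2} :=
    measurableSet_lt (measurable_norm.comp measurable_fst) measurable_snd
  refine (h1.indicator hm).congr (Filter.Eventually.of_forall fun p => ?_)
  by_cases hp : ‖p.1‖ < p.2 <;> simp [indicator, hp, Function.uncurry]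

lemma integral_mul_indicator_shell {f : EuclideanSpace ℝ (Fin N) → ℝ} {a R r : ℝ} (hr : r ≤ R)
    (u : ℝ → ℝ) :
    ∫ z in shell N a R, f z * (Ioi ‖z‖).indicator u r = u r * ∫ z in shell N a r, f z := by
  have h1 : (fun z : EuclideanSpace ℝ (Fin N) => f z * (Ioi ‖z‖).indicator u r) =
      {z | ‖z‖ < r}.indicator fun z => u r * f z := by
    ext z
    by_cases hz : ‖z‖ < r <;> simp [indicator, hz, mul_comm]
  have h2 : shell N a R ∩ {z | ‖z‖ < r} = shell N a r := by
    ext z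
    simp only [shell, mem_inter_iff, mem_ofPred_eq]
    constructor
    · exact fun h => ⟨h.1.1, h.2⟩
    · exact fun h => ⟨⟨h.1, h.2.trans_le hr⟩, h.2⟩
  rw [h1, setIntegral_indicator (measurableSet_lt measurable_norm measurable_const), h2,
    integral_const_mul]

/-- As a function of r, the shell integral is a marginal of an integrable function on the product of
a shell and an interval. -/
lemma locallyIntegrableOn_integral_shell {f : EuclideanSpace ℝ (Fin N) → ℝ} {a : ℝ}
    (hf : ∀ R, IntegrableOn f (shell N a R)) :
    LocallyIntegrableOn (fun r => ∫ z in shell N a r, f z) (Ioi a) := by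
  rw [locallyIntegrableOn_iff isOpen_Ioi.isLocallyClosed]
  intro K hKa hK
  obtain ⟨R, hR⟩ := hK.bddAbove
  have h1 := (integrable_prod_indicator_shell (hf (R + 1))
    (u := fun _ => 1) (integrableOn_const (by simp))).integral_prod_right
  have h2 : IntegrableOn (fun r => ∫ z in shell N a r, f z) (Ioo a (R + 1)) := by
    refine Integrable.congr h1 ?_
    filter_upwards [ae_restrict_mem measurableSet_Ioo] with r hr
    have := integral_mul_indicator_shell (f := f) (a := a) hr.2.le (fun _ => 1)
    simpa [Function.uncurry] using this
  exact h2.mono_set fun r hr => ⟨hKa hr, (hR hr).trans_lt (lt_add_one R)⟩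

/-- Integration by parts against a radial test function. -/
lemma integral_mul_comp_norm {f : EuclideanSpace ℝ (Fin N) → ℝ} {a : ℝ}
    (hf : ∀ R, IntegrableOn f (shell N a R)) {η : ℝ → ℝ} (hη : tsupport η ⊆ Ioi a)
    (hs : ContDiff ℝ ∞ η) (hc : HasCompactSupport η) :
    ∫ z, f z * η ‖z‖ = -∫ r, deriv η r * ∫ z in shell N a r, f z := by
  obtain ⟨R, hR⟩ := hc.isCompact.bddAbove
  have hη0 : ∀ r, r ∉ Ioo a (R + 1) → η r = 0 ∧ deriv η r = 0 := by
    intro r hr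
    have : r ∉ tsupport η := fun h => hr ⟨hη h, (hR h).trans_lt (lt_add_one R)⟩
    exact ⟨image_eq_zero_of_notMem_tsupport this,
      image_eq_zero_of_notMem_tsupport fun h => this (tsupport_deriv_subset h)⟩
  have hd : Continuous (deriv η) := hs.continuous_deriv (by simp)
  have hswap := integral_integral_swap (integrable_prod_indicator_shell (hf (R + 1))
    (u := deriv η) (hd.integrableOn_Icc.mono_set Ioo_subset_Icc_self))
  -- For fixed z, integrating the derivative of η over (|z|, R + 1) gives -η(|z|), since η vanishes
  -- at R + 1.
  have hl : ∫ z in shell N a (R + 1), ∫ r in Ioo a (R + 1), f z * (Ioi ‖z‖).indicator (deriv η) r =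
      -∫ z, f z * η ‖z‖ := by
    rw [← integral_neg, ← setIntegral_eq_integral_of_forall_compl_eq_zero
      (s := shell N a (R + 1)) (f := fun z => -(f z * η ‖z‖))]
    · refine setIntegral_congr_fun (measurableSet_shell _ _) fun z hz => ?_
      have h1 : Ioo a (R + 1) ∩ Ioi ‖z‖ = Ioo ‖z‖ (R + 1) := by
        ext r
        simp only [mem_inter_iff, mem_Ioo, mem_Ioi]
        exact ⟨fun h => ⟨h.2, h.1.2⟩, fun h => ⟨⟨hz.1.trans h.1, h.2⟩, h.1⟩⟩
      rw [integral_const_mul, setIntegral_indicator measurableSet_Ioi, h1,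
        ← integral_Ioc_eq_integral_Ioo, ← intervalIntegral.integral_of_le hz.2.le,
        intervalIntegral.integral_deriv_eq_sub
          (fun x _ => (hs.differentiable (by simp)) x) (hd.intervalIntegrable _ _),
        (hη0 (R + 1) (by simp)).1]
      ring
    · intro z hz
      simp [(hη0 ‖z‖ hz).1]
  have hr : ∫ r in Ioo a (R + 1), ∫ z in shell N a (R + 1), f z * (Ioi ‖z‖).indicator (deriv η) r =
      ∫ r, deriv η r * ∫ z in shell N a r, f z := by
    rw [← setIntegral_eq_integral_of_forall_compl_eq_zero (s := Ioo a (R + 1))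
      (f := fun r => deriv η r * ∫ z in shell N a r, f z)]
    · refine setIntegral_congr_fun measurableSet_Ioo fun r hr => ?_
      exact integral_mul_indicator_shell hr.2.le _
    · intro r hr
      simp [(hη0 r hr).2]
  rw [← hr, ← hswap, hl, neg_neg]

end Shell

/-! ### The radial profile as a primitive of the gradient. -/

section Representation

variable {N : ℕ} {v : EuclideanSpace ℝ (Fin N) → ℝ}
  {g : EuclideanSpace ℝ (Fin N) → EuclideanSpace ℝ (Fin N)} {w : ℝ → ℝ} {a : ℝ}

/-- On a shell away from the origin, v |x|^(1-N) is integrable, and polar coordinates turn this into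
integrability of w on an interval. -/
lemma locallyIntegrableOn_of_radial (hN : 2 ≤ N) (hv : LocallyIntegrable v)
    (hw : ∀ᵐ x, v x = w ‖x‖) (ha : 0 < a) : LocallyIntegrableOn w (Ioi a) := by
  rw [locallyIntegrableOn_iff isOpen_Ioi.isLocallyClosed]
  intro K hKa hK
  obtain ⟨R, hR⟩ := hK.bddAbove
  have h1 : IntegrableOn (fun x : EuclideanSpace ℝ (Fin N) => w ‖x‖ / ‖x‖ ^ (N - 1))
      (closedShell N a R) := by
    refine (integrableOn_inv_norm_pow_smul hv ha R (N - 1)).congr (ae_restrict_of_ae ?_)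
    filter_upwards [hw] with x hx
    rw [hx, smul_eq_mul, div_eq_inv_mul]
  have h2 : Integrable fun x : EuclideanSpace ℝ (Fin N) =>
      (Icc a R).indicator w ‖x‖ / ‖x‖ ^ (N - 1) := by
    refine ((integrable_indicator_iff (measurableSet_closedShell a R)).2 h1).congr (Filter.Eventually.of_forall fun x => ?_)
    by_cases hx : a ≤ ‖x‖ ∧ ‖x‖ ≤ R <;> simp [closedShell, indicator, hx]
  rw [integrable_norm_div_pow hN] at h2
  have h3 := h2.mono_set (show K ⊆ Ioi 0 from fun r hr => ha.trans (hKa hr))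
  exact h3.congr_fun (fun r hr => indicator_of_mem (show r ∈ Icc a R from
    ⟨le_of_lt (hKa hr), hR hr⟩) _)
    hK.measurableSet

lemma norm_inner_div_pow_le (hN : 2 ≤ N) (y x : EuclideanSpace ℝ (Fin N)) :
    ‖inner ℝ y x / ‖x‖ ^ N‖ ≤ (‖x‖ ^ (N - 1))⁻¹ * ‖y‖ := by
  rcases eq_or_ne x 0 with rfl | hx
  · simp only [inner_zero_right, zero_div, norm_zero]
    positivity
  have hx' := norm_pos_iff.2 hx
  rw [norm_div, norm_pow, norm_norm, div_le_iff₀ (by positivity)]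
  obtain ⟨n, rfl⟩ : ∃ n, N = n + 1 := ⟨N - 1, by omega⟩
  calc ‖inner ℝ y x‖ ≤ ‖y‖ * ‖x‖ := norm_inner_le_norm y x
    _ = _ := by
      simp only [Nat.add_sub_cancel]
      field_simp
      ring

lemma integrableOn_inner_div_pow (hN : 2 ≤ N) (hg : LocallyIntegrable g) (ha : 0 < a) (R : ℝ) :
    IntegrableOn (fun x => inner ℝ (g x) x / ‖x‖ ^ N) (shell N a R) := by
  have h1 := ((integrableOn_inv_norm_pow_smul hg ha R (N - 1)).mono_set (shell_subset a R)).norm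
  refine Integrable.mono' h1 ?_ (Filter.Eventually.of_forall fun x => ?_)
  · refine (AEStronglyMeasurable.mul (AEStronglyMeasurable.inner
      hg.aestronglyMeasurable.restrict ?_) ?_)
    · exact continuous_id.aestronglyMeasurable
    · exact ((measurable_norm.pow_const N).inv).aestronglyMeasurable
  · refine (norm_inner_div_pow_le hN (g x) x).trans_eq ?_
    rw [norm_smul, norm_inv, norm_pow, norm_norm]

/-- The radial profile of a radial weakly differentiable function is, away from the origin, a
primitive of the spherical integrals of the radial part of the gradient. -/
theorem HasWeakGradient.profile_ae_eq (hN : 2 ≤ N) (hv : HasWeakGradient v g)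
    (hw : ∀ᵐ x, v x = w ‖x‖) (ha : 0 < a) :
    ∃ c, ∀ᵐ r, a < r →
      sphereArea N * w r = c + ∫ x in shell N a r, inner ℝ (g x) x / ‖x‖ ^ N := by
  have hf := integrableOn_inner_div_pow hN hv.locallyIntegrable_grad ha
  have hwl := locallyIntegrableOn_of_radial hN hv.locallyIntegrable hw ha
  have hA := locallyIntegrableOn_integral_shell hf
  have hint : ∀ {u : ℝ → ℝ}, LocallyIntegrableOn u (Ioi a) → ∀ η : ℝ → ℝ, ContDiff ℝ ∞ η →
      HasCompactSupport η → tsupport η ⊆ Ioi a → Integrable fun r => deriv η r * u r := by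
    intro u hu η hη hηc hηt
    have h1 : IntegrableOn (fun r => deriv η r * u r) (tsupport η) :=
      (hu.integrableOn_compact_subset hηt hηc).continuousOn_mul
        (hη.continuous_deriv (by simp)).continuousOn hηc
    refine (integrableOn_iff_integrable_of_support_subset ?_).1 h1
    exact (Function.support_mul_subset_left _ _).trans
      ((subset_tsupport _).trans tsupport_deriv_subset)
  obtain ⟨c, hc⟩ := ae_eq_const_of_integral_deriv_mul_eq_zero
    ((hwl.smul (sphereArea N)).sub hA) (fun η hη hηc hηt => by
      have h1 := hv.integral_radial hN ha hηt hη hηc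
      have h2 : ∫ x, v x * (deriv η ‖x‖ / ‖x‖ ^ (N - 1)) =
          ∫ x : EuclideanSpace ℝ (Fin N), (deriv η ‖x‖ * w ‖x‖) / ‖x‖ ^ (N - 1) :=
        integral_congr_ae (by filter_upwards [hw] with x hx; rw [hx]; ring)
      rw [h2, integral_norm_div_pow hN (fun r => deriv η r * w r),
        integral_mul_comp_norm hf hηt hη hηc, neg_neg,
        setIntegral_eq_integral_of_forall_compl_eq_zero] at h1
      · have h3 : ∀ r, deriv η r * (sphereArea N • w - fun r => ∫ x in shell N a r,
            inner ℝ (g x) x / ‖x‖ ^ N) r = sphereArea N * (deriv η r * w r) -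
            deriv η r * ∫ x in shell N a r, inner ℝ (g x) x / ‖x‖ ^ N := by
          intro r
          simp only [Pi.sub_apply, Pi.smul_apply, smul_eq_mul]
          ring
        simp only [h3]
        rw [integral_sub ((hint hwl η hη hηc hηt).const_mul _) (hint hA η hη hηc hηt),
          integral_const_mul, h1, sub_self]
      · intro r hr
        rw [deriv_eq_zero_of_tsupport_subset_Ioi hηt ((not_lt.1 hr).trans ha.le), zero_mul])
  refine ⟨c, ?_⟩
  filter_upwards [hc] with r hr har
  rw [← hr har]
  simp

lemma shell_sdiff_shell_subset {r s b : ℝ} (hsb : s ≤ b) :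
    shell N a s \ shell N a r ⊆ closedShell N r b := fun _ hx =>
  ⟨not_lt.1 fun h => hx.2 ⟨hx.1.1, h⟩, hx.1.2.le.trans hsb⟩

/-- The oscillation of the radial profile is controlled by the gradient. -/
theorem HasWeakGradient.exists_abs_profile_sub_le (hN : 2 ≤ N) (hv : HasWeakGradient v g)
    (hw : ∀ᵐ x, v x = w ‖x‖) :
    ∃ G : Set ℝ, (∀ᵐ r, r ∈ G) ∧ ∀ r ∈ G, ∀ s ∈ G, ∀ b, 0 < r → r < s → s ≤ b →
      |w r - w s| ≤ (sphereArea N)⁻¹ * ∫ x in closedShell N r b, (‖x‖ ^ (N - 1))⁻¹ * ‖g x‖ := by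
  have hpos : ∀ n : ℕ, (0 : ℝ) < 1 / (n + 1) := fun n => Nat.one_div_pos_of_nat
  -- The constant depends on the inner radius a; the sequence a = 1/(n + 1) reaches every r > 0 with
  -- a single null set, and the constant cancels in w(s) - w(r).
  choose c hc using fun n : ℕ => hv.profile_ae_eq hN hw (hpos n)
  refine ⟨_, ae_all_iff.2 hc, fun r hr s hs b hr0 hrs hsb => ?_⟩
  obtain ⟨n, hn⟩ := exists_nat_one_div_lt hr0
  have hr1 := hr n hn
  have hs1 := hs n (hn.trans hrs)
  set a : ℝ := 1 / ((n : ℝ) + 1)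
  have hf := integrableOn_inner_div_pow (g := g) hN hv.locallyIntegrable_grad (hpos n) s
  have hsub : shell N a r ⊆ shell N a s := fun x hx => ⟨hx.1, hx.2.trans hrs⟩
  have hdiff := setIntegral_sdiff (measurableSet_shell a r) hf hsub
  have hgi : IntegrableOn (fun x => (‖x‖ ^ (N - 1))⁻¹ * ‖g x‖) (closedShell N r b) := by
    have := (integrableOn_inv_norm_pow_smul hv.locallyIntegrable_grad hr0 b (N - 1)).norm
    simpa [IntegrableOn, norm_smul] using this
  have hle : |∫ x in shell N a s \ shell N a r, inner ℝ (g x) x / ‖x‖ ^ N| ≤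
      ∫ x in closedShell N r b, (‖x‖ ^ (N - 1))⁻¹ * ‖g x‖ := by
    rw [← Real.norm_eq_abs]
    refine (norm_integral_le_integral_norm _).trans ?_
    refine (integral_mono (hf.mono_set sdiff_subset).norm
      (hgi.mono_set (shell_sdiff_shell_subset hsb)) fun x =>
        norm_inner_div_pow_le hN (g x) x).trans ?_
    exact setIntegral_mono_set hgi (Filter.Eventually.of_forall fun x => by simp only; positivity)
      (shell_sdiff_shell_subset hsb).eventuallyLE
  have hσ := sphereArea_pos hN
  have heq : sphereArea N * (w s - w r) =
      ∫ x in shell N a s \ shell N a r, inner ℝ (g x) x / ‖x‖ ^ N := by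
    rw [hdiff, mul_sub, hr1, hs1]
    ring
  rw [← heq, abs_mul, abs_of_pos hσ, abs_sub_comm] at hle
  rwa [← div_eq_inv_mul, le_div_iff₀' hσ]

end Representation

/-! ### Jensen's inequality and properties of the modular. -/

/-- Jensen's inequality with respect to a probability density on a set. -/
lemma IsNDensity.integral_jensen {h : ℝ → ℝ} {q : ℝ} (H : IsNDensity h q) {α : Type*}
    [MeasurableSpace α] {μ : Measure α} {k b : α → ℝ} (hk : ∀ x, 0 ≤ k x) (hb : ∀ x, 0 ≤ b x)
    (hki : Integrable k μ) (hk1 : ∫ x, k x ∂μ = 1) (hkb : Integrable (fun x => k x * b x) μ)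
    (hkH : Integrable (fun x => k x * ∫ s in (0 : ℝ)..b x, h s) μ) :
    ∫ s in (0 : ℝ)..(∫ x, k x * b x ∂μ), h s ≤ ∫ x, k x * (∫ s in (0 : ℝ)..b x, h s) ∂μ := by
  set m := ∫ x, k x * b x ∂μ with hm
  have hm0 : 0 ≤ m := MeasureTheory.integral_nonneg fun x => mul_nonneg (hk x) (hb x)
  rcases hm0.eq_or_lt with h0 | h0
  · rw [← h0, intervalIntegral.integral_same]
    exact MeasureTheory.integral_nonneg fun x => mul_nonneg (hk x) (H.integral_nonneg (hb x))
  set T := ∫ s in (0 : ℝ)..m, h s with hT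
  -- The tangent at the mean m, averaged against k, returns its value T at m.
  have h1 : ∫ x, (T - h m * m) * k x + h m * (k x * b x) ∂μ = T := by
    rw [integral_add (hki.const_mul _) (hkb.const_mul _), integral_const_mul, integral_const_mul,
      hk1, ← hm]
    ring
  rw [← h1]
  refine integral_mono ((hki.const_mul _).add (hkb.const_mul _)) hkH fun x => ?_
  have h2 := mul_le_mul_of_nonneg_left (H.tangent_le h0 (hb x)) (hk x)
  have h3 : (T - h m * m) * k x + h m * (k x * b x) = k x * (T + h m * (b x - m)) := by ring
  simp only
  rw [h3]
  exact h2

variable {N : ℕ} {φ : EuclideanSpace ℝ (Fin N) → ℝ → ℝ}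

/-- Continuity is known only for positive second argument, so φ is extended by zero, and the
variable limit |t| is moved into an indicator before integrating out s. -/
lemma measurable_uncurry_Phi (hcont : ContinuousOn (Function.uncurry φ) (univ ×ˢ Ioi 0)) :
    Measurable fun p : EuclideanSpace ℝ (Fin N) × ℝ => Phi φ p.1 p.2 := by
  classical
  have hs : MeasurableSet ((univ : Set (EuclideanSpace ℝ (Fin N))) ×ˢ Ioi (0 : ℝ)) :=
    MeasurableSet.univ.prod measurableSet_Ioi
  have hψ : Measurable (((univ : Set (EuclideanSpace ℝ (Fin N))) ×ˢ Ioi (0 : ℝ)).piecewise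
      (Function.uncurry φ) fun _ => 0) := hcont.measurable_piecewise continuousOn_const hs
  set ψ := ((univ : Set (EuclideanSpace ℝ (Fin N))) ×ˢ Ioi (0 : ℝ)).piecewise
      (Function.uncurry φ) fun _ => 0 with hψd
  have hm : MeasurableSet {y : (EuclideanSpace ℝ (Fin N) × ℝ) × ℝ | 0 < y.2 ∧ y.2 ≤ |y.1.2|} :=
    (measurableSet_lt measurable_const measurable_snd).inter
      (measurableSet_le measurable_snd (measurable_snd.comp measurable_fst).abs)
  have hF : Measurable ({y : (EuclideanSpace ℝ (Fin N) × ℝ) × ℝ |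
      0 < y.2 ∧ y.2 ≤ |y.1.2|}.indicator fun y => ψ (y.1.1, y.2) * y.2) :=
    ((hψ.comp (by fun_prop : Measurable fun y : (EuclideanSpace ℝ (Fin N) × ℝ) × ℝ =>
      (y.1.1, y.2))).mul measurable_snd).indicator hm
  have h1 := (StronglyMeasurable.integral_prod_right (ν := (volume : Measure ℝ))
    (f := fun (p : EuclideanSpace ℝ (Fin N) × ℝ) s => {y : (EuclideanSpace ℝ (Fin N) × ℝ) × ℝ |
      0 < y.2 ∧ y.2 ≤ |y.1.2|}.indicator (fun y => ψ (y.1.1, y.2) * y.2) (p, s))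
    hF.stronglyMeasurable).measurable
  convert h1 using 2 with p
  rw [Phi, intervalIntegral.integral_of_le (abs_nonneg _), ← integral_indicator measurableSet_Ioc]
  congr 1 with s
  by_cases hs : 0 < s ∧ s ≤ |p.2|
  · simp [indicator, hs, hψd]
  · simp [indicator, hs]

section Growth

variable {q : ℝ}

lemma Phi_nonneg (hd : ∀ x, IsNDensity (fun s => φ x s * s) q) (x : EuclideanSpace ℝ (Fin N))
    (t : ℝ) : 0 ≤ Phi φ x t := (hd x).integral_nonneg (abs_nonneg t)

lemma Phi_of_nonneg (x : EuclideanSpace ℝ (Fin N)) {t : ℝ} (ht : 0 ≤ t) :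
    Phi φ x t = ∫ s in (0 : ℝ)..t, φ x s * s := by rw [Phi, abs_of_nonneg ht]

/-- `Function.invFunOn` is a true inverse only at attained values; surjectivity provides this, and
strict monotonicity concludes. -/
lemma le_PhiInv (hd : ∀ x, IsNDensity (fun s => φ x s * s) q) {x : EuclideanSpace ℝ (Fin N)}
    {t y : ℝ} (ht : 0 ≤ t) (hty : Phi φ x t ≤ y) : t ≤ PhiInv φ x y := by
  obtain ⟨τ, hτ, hτy⟩ := (hd x).surjOn ((Phi_nonneg hd x t).trans hty)
  have hex : ∃ τ ∈ Ici (0 : ℝ), Phi φ x τ = y := ⟨τ, hτ, by rw [Phi_of_nonneg x hτ, hτy]⟩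
  have h1 : 0 ≤ PhiInv φ x y := Function.invFunOn_mem hex
  have h2 : Phi φ x (PhiInv φ x y) = y := Function.invFunOn_eq hex
  rw [← h2, Phi_of_nonneg x ht, Phi_of_nonneg x h1] at hty
  exact ((hd x).strictMonoOn.le_iff_le ht h1).1 hty

/-- Doubling removes the scale τ at the cost of max(τ, 1)^q; the maximum is needed because the
scaling factor must be at least 1. -/
lemma MemLPhi.integrable (hcont : ContinuousOn (Function.uncurry φ) (univ ×ˢ Ioi 0))
    (hd : ∀ x, IsNDensity (fun s => φ x s * s) q) {u : EuclideanSpace ℝ (Fin N) → ℝ}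
    (hu : MemLPhi φ u) : Integrable fun x => Phi φ x |u x| := by
  obtain ⟨hum, τ, hτ, hfin⟩ := hu
  have hmeas : ∀ f : EuclideanSpace ℝ (Fin N) → ℝ, AEMeasurable f →
      AEStronglyMeasurable (fun x => Phi φ x (f x)) := fun f hf =>
    ((measurable_uncurry_Phi hcont).comp_aemeasurable (aemeasurable_id.prodMk hf)).aestronglyMeasurable
  have hi : Integrable fun x => Phi φ x (|u x| / τ) := by
    refine ⟨hmeas _ (hum.abs.div_const τ), ?_⟩
    rw [hasFiniteIntegral_iff_ofReal (Filter.Eventually.of_forall fun x => Phi_nonneg hd x _)]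
    exact hfin
  refine (hi.const_mul (max τ 1 ^ q)).mono' (hmeas _ hum.abs)
    (Filter.Eventually.of_forall fun x => ?_)
  have h0 : 0 ≤ |u x| / τ := by positivity
  rw [Real.norm_of_nonneg (Phi_nonneg hd x _), Phi_of_nonneg x (abs_nonneg _), Phi_of_nonneg x h0]
  refine le_trans ?_ ((hd x).integral_mul_le (le_max_right τ 1) h0)
  refine (hd x).strictMonoOn.monotoneOn (abs_nonneg (u x))
    (mul_nonneg (by positivity) h0) ?_
  calc |u x| = τ * (|u x| / τ) := by field_simp
    _ ≤ max τ 1 * (|u x| / τ) := mul_le_mul_of_nonneg_right (le_max_left _ _) h0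

/-- Gronwall: |∂ₛΦ| ≤ κΦ makes e^(κs) Φ(s e, t) nondecreasing in s, and a radial step of length at
most 1 costs a factor e^κ. -/
lemma Phi_le_exp_mul_Phi {κ : ℝ} (hκ : 0 < κ)
    (hd : ∀ x, IsNDensity (fun s => φ x s * s) q)
    (hrad : ∀ x y : EuclideanSpace ℝ (Fin N), ‖x‖ = ‖y‖ → ∀ t : ℝ, 0 < t → Phi φ x t = Phi φ y t)
    (hder : ∀ e : EuclideanSpace ℝ (Fin N), ‖e‖ = 1 → ∀ s : ℝ, 0 < s → ∀ t : ℝ,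
      DifferentiableAt ℝ (fun σ : ℝ => Phi φ (σ • e) t) s ∧
        |deriv (fun σ : ℝ => Phi φ (σ • e) t) s| ≤ κ * Phi φ (s • e) t)
    {x z : EuclideanSpace ℝ (Fin N)} (hx : 0 < ‖x‖) (hxz : ‖x‖ ≤ ‖z‖) (hzx : ‖z‖ ≤ ‖x‖ + 1)
    {t : ℝ} (ht : 0 ≤ t) : Phi φ x t ≤ Real.exp κ * Phi φ z t := by
  rcases ht.eq_or_lt with rfl | ht
  · simp [Phi]
  set e := ‖x‖⁻¹ • x with he
  have he1 : ‖e‖ = 1 := by rw [he, norm_smul, norm_inv, norm_norm, inv_mul_cancel₀ hx.ne']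
  have hdf : ∀ s ∈ Ioi (0 : ℝ), HasDerivAt (fun σ => Real.exp (κ * σ) * Phi φ (σ • e) t)
      (Real.exp (κ * s) * (κ * 1) * Phi φ (s • e) t +
        Real.exp (κ * s) * deriv (fun σ : ℝ => Phi φ (σ • e) t) s) s := fun s hs =>
    (((hasDerivAt_id s).const_mul κ).exp).mul (hder e he1 s hs t).1.hasDerivAt
  have hmono : MonotoneOn (fun σ => Real.exp (κ * σ) * Phi φ (σ • e) t) (Ioi 0) := by
    refine monotoneOn_of_deriv_nonneg (convex_Ioi 0)
      (fun s hs => (hdf s hs).continuousAt.continuousWithinAt) ?_ ?_ <;> rw [interior_Ioi]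
    · exact fun s hs => (hdf s hs).differentiableAt.differentiableWithinAt
    · intro s hs
      rw [(hdf s hs).deriv]
      have h1 := neg_le_of_abs_le (hder e he1 s hs t).2
      have h2 := Real.exp_pos (κ * s)
      nlinarith
  have h1 := hmono hx (hx.trans_le hxz) hxz
  have hxe : ‖x‖ • e = x := by rw [he, smul_smul, mul_inv_cancel₀ hx.ne', one_smul]
  have hze : Phi φ (‖z‖ • e) t = Phi φ z t :=
    hrad _ _ (by rw [norm_smul, he1, norm_norm, mul_one]) t ht
  simp only [hxe, hze] at h1
  have h2 : Real.exp (κ * ‖z‖) ≤ Real.exp (κ * ‖x‖) * Real.exp κ := by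
    rw [← Real.exp_add]
    exact Real.exp_le_exp.2 (by nlinarith)
  have h3 := h1.trans (mul_le_mul_of_nonneg_right h2 (Phi_nonneg hd z t))
  rw [mul_assoc] at h3
  exact le_of_mul_le_mul_left h3 (Real.exp_pos _)

end Growth

/-! ### Averaging over a shell of width one. -/

lemma integral_closedShell_weight (hN : 2 ≤ N) {r : ℝ} (hr : 0 < r) :
    IntegrableOn (fun z : EuclideanSpace ℝ (Fin N) => (sphereArea N)⁻¹ * (‖z‖ ^ (N - 1))⁻¹)
      (closedShell N r (r + 1)) ∧
    ∫ z in closedShell N r (r + 1), (sphereArea N)⁻¹ * (‖z‖ ^ (N - 1))⁻¹ = 1 := by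
  constructor
  · have := integrableOn_inv_norm_pow_smul (N := N) (locallyIntegrable_const (1 : ℝ)) hr (r + 1)
      (N - 1)
    simp only [smul_eq_mul, mul_one] at this
    exact this.const_mul _
  · have h1 := integral_norm_div_pow hN ((Icc r (r + 1)).indicator fun _ => 1)
    rw [setIntegral_indicator measurableSet_Icc,
      inter_eq_self_of_subset_right (show Icc r (r + 1) ⊆ Ioi 0 from
        fun s hs => hr.trans_le hs.1)] at h1
    simp only [integral_const, MeasurableSet.univ, measureReal_restrict_apply, univ_inter,
      Real.volume_real_Icc, add_sub_cancel_left, zero_le_one, sup_of_le_left, smul_eq_mul,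
      mul_one] at h1
    rw [integral_const_mul, ← integral_indicator (measurableSet_closedShell _ _)]
    rw [inv_mul_eq_iff_eq_mul₀ (sphereArea_pos hN).ne', mul_one, ← h1]
    congr 1 with z
    by_cases hz : r ≤ ‖z‖ ∧ ‖z‖ ≤ r + 1 <;> simp [closedShell, indicator, hz]

/-- The pointwise modular estimate for radial functions of a Musielak-Sobolev space. -/
theorem MemW1Phi.ae_Phi_le (hN : 2 ≤ N) {q c : ℝ}
    (hcont : ContinuousOn (Function.uncurry φ) (univ ×ˢ Ioi 0))
    (hd : ∀ x, IsNDensity (fun s => φ x s * s) q) (hc : 0 ≤ c)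
    (hshift : ∀ x z : EuclideanSpace ℝ (Fin N), 0 < ‖x‖ → ‖x‖ ≤ ‖z‖ → ‖z‖ ≤ ‖x‖ + 1 →
      ∀ t, 0 ≤ t → Phi φ x t ≤ c * Phi φ z t)
    {v : EuclideanSpace ℝ (Fin N) → ℝ} {g : EuclideanSpace ℝ (Fin N) → EuclideanSpace ℝ (Fin N)}
    (hv : MemW1Phi φ v g) (hr : IsRadial v) :
    ∀ᵐ x, Phi φ x |v x| ≤ 2 ^ q * c / sphereArea N / ‖x‖ ^ (N - 1) *
      ∫ y, (Phi φ y |v y| + Phi φ y ‖g y‖) := by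
  obtain ⟨w, hw⟩ := hr
  have hσ := sphereArea_pos hN
  have hvi := hv.memLPhi.integrable hcont hd
  have hgi := hv.memLPhi_grad.integrable hcont hd
  simp only [abs_norm] at hgi
  obtain ⟨G, hG, hosc⟩ := hv.hasWeakGradient.exists_abs_profile_sub_le hN hw
  have hGx := ae_norm_of_ae hN hG
  have := nontrivial_euclideanSpace hN
  have hne : ∀ᵐ x : EuclideanSpace ℝ (Fin N), x ≠ 0 := by simp [ae_iff]
  filter_upwards [hw, hGx, hne] with x hwx hxG hx0
  have hr0 : 0 < ‖x‖ := norm_pos_iff.2 hx0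
  set r := ‖x‖ with hrdef
  set K := closedShell N r (r + 1) with hK
  have hKm : MeasurableSet K := measurableSet_closedShell _ _
  set k : EuclideanSpace ℝ (Fin N) → ℝ := fun z => (sphereArea N)⁻¹ * (‖z‖ ^ (N - 1))⁻¹ with hk
  have hki : IntegrableOn k K := (integral_closedShell_weight hN hr0).1
  have hk1 : ∫ z in K, k z = 1 := (integral_closedShell_weight hN hr0).2
  have hk0 : ∀ z, 0 ≤ k z := fun z => by positivity
  have hkle : ∀ z ∈ K, k z ≤ (sphereArea N)⁻¹ * (r ^ (N - 1))⁻¹ := fun z hz => by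
    have := hz.1
    simp only [hk]
    gcongr
  have hkm : Measurable k := ((measurable_norm.pow_const _).inv).const_mul _
  -- integrability of the weighted modulars with the first variable frozen at `x`
  have hbd : ∀ b : EuclideanSpace ℝ (Fin N) → ℝ, AEMeasurable b → (∀ z, 0 ≤ b z) →
      Integrable (fun z => Phi φ z (b z)) →
      IntegrableOn (fun z => k z * Phi φ x (b z)) K ∧
      ∫ z in K, k z * Phi φ x (b z) ≤
        (sphereArea N)⁻¹ * (r ^ (N - 1))⁻¹ * c * ∫ z, Phi φ z (b z) := by
    intro b hbm hb hbi
    have hle : ∀ z ∈ K, k z * Phi φ x (b z) ≤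
        (sphereArea N)⁻¹ * (r ^ (N - 1))⁻¹ * c * Phi φ z (b z) := fun z hz => by
      rw [mul_assoc _ c]
      exact mul_le_mul (hkle z hz) (hshift x z hr0 hz.1 hz.2 _ (hb z)) (Phi_nonneg hd _ _)
        (by positivity)
    have hint : IntegrableOn (fun z => k z * Phi φ x (b z)) K := by
      refine Integrable.mono' (hbi.const_mul _).integrableOn ?_
        ((ae_restrict_mem hKm).mono fun z hz => ?_) (g := fun z =>
          (sphereArea N)⁻¹ * (r ^ (N - 1))⁻¹ * c * Phi φ z (b z))
      · exact (hkm.aemeasurable.mul ((measurable_uncurry_Phi hcont).comp_aemeasurable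
          (aemeasurable_const.prodMk hbm))).aestronglyMeasurable.restrict
      · rw [Real.norm_of_nonneg (mul_nonneg (hk0 z) (Phi_nonneg hd _ _))]
        exact hle z hz
    refine ⟨hint, ?_⟩
    rw [← integral_const_mul]
    refine (setIntegral_mono_on hint (hbi.const_mul _).integrableOn hKm hle).trans ?_
    exact setIntegral_le_integral (hbi.const_mul _) (Filter.Eventually.of_forall fun z =>
      mul_nonneg (by positivity) (Phi_nonneg hd _ _))
  obtain ⟨hv1, hv2⟩ := hbd (fun z => |v z|) hv.memLPhi.1.abs (fun z => abs_nonneg _) hvi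
  obtain ⟨hg1, hg2⟩ := hbd (fun z => ‖g z‖) hv.memLPhi_grad.1 (fun z => norm_nonneg _) hgi
  set D := ∫ z in K, k z * ‖g z‖ with hD
  have hD0 : 0 ≤ D := MeasureTheory.integral_nonneg fun z => mul_nonneg (hk0 z) (norm_nonneg _)
  have hkg : IntegrableOn (fun z => k z * ‖g z‖) K := by
    have := (integrableOn_inv_norm_pow_smul hv.hasWeakGradient.locallyIntegrable_grad hr0 (r + 1)
      (N - 1)).norm.const_mul (sphereArea N)⁻¹
    simpa [IntegrableOn, norm_smul, hk, mul_assoc] using this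
  have hjensen : Phi φ x D ≤ ∫ z in K, k z * Phi φ x ‖g z‖ := by
    rw [Phi_of_nonneg x hD0]
    simp only [fun z => Phi_of_nonneg (φ := φ) x (norm_nonneg (g z))] at hg1 ⊢
    exact (hd x).integral_jensen hk0 (fun z => norm_nonneg (g z)) hki hk1 hkg hg1
  -- The oscillation bound compares v(x) with v(z) for almost every z in the shell; doubling then
  -- splits the sum under Φ(x,·).
  have hpt : ∀ᵐ z ∂volume.restrict K, k z * Phi φ x |v x| ≤
      2 ^ q * (k z * Phi φ x |v z|) + 2 ^ q * Phi φ x D * k z := by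
    filter_upwards [ae_restrict_mem hKm, ae_restrict_of_ae hw, ae_restrict_of_ae hGx]
      with z hzK hwz hzG
    have h1 : |v x| ≤ |v z| + D := by
      have h2 : |v x - v z| ≤ D := by
        rcases hzK.1.eq_or_lt with h | h
        · rw [hwx, hwz, ← h, sub_self, abs_zero]
          exact hD0
        · rw [hwx, hwz]
          refine (hosc r hxG ‖z‖ hzG (r + 1) hr0 h hzK.2).trans_eq ?_
          rw [hD, ← integral_const_mul]
          simp only [hk, hK, mul_assoc]
      have := abs_sub_abs_le_abs_sub (v x) (v z)
      linarith
    have h3 : Phi φ x |v x| ≤ 2 ^ q * (Phi φ x |v z| + Phi φ x D) := by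
      rw [Phi_of_nonneg x (abs_nonneg _), Phi_of_nonneg x (abs_nonneg _), Phi_of_nonneg x hD0]
      exact ((hd x).strictMonoOn.monotoneOn (abs_nonneg (v x))
        (add_nonneg (abs_nonneg (v z)) hD0) h1).trans
        ((hd x).integral_add_le (abs_nonneg _) hD0)
    have h4 := mul_le_mul_of_nonneg_left h3 (hk0 z)
    linarith
  -- The left side does not depend on z apart from k, which has mass one.
  have h5 : ∫ z in K, k z * Phi φ x |v x| ≤
      ∫ z in K, 2 ^ q * (k z * Phi φ x |v z|) + 2 ^ q * Phi φ x D * k z :=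
    integral_mono_ae (hki.mul_const _) ((hv1.const_mul _).add (hki.const_mul _)) hpt
  rw [integral_mul_const, hk1, integral_add (hv1.const_mul _) (hki.const_mul _),
    integral_const_mul (2 ^ q), integral_const_mul (2 ^ q * Phi φ x D), hk1, one_mul, mul_one] at h5
  have h6 : Phi φ x |v x| ≤ 2 ^ q * ((sphereArea N)⁻¹ * (r ^ (N - 1))⁻¹ * c *
      (∫ z, Phi φ z |v z|) + (sphereArea N)⁻¹ * (r ^ (N - 1))⁻¹ * c * ∫ z, Phi φ z ‖g z‖) := by
    refine h5.trans ?_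
    rw [← mul_add]
    exact mul_le_mul_of_nonneg_left (add_le_add hv2 (hjensen.trans hg2)) (by positivity)
  refine h6.trans_eq ?_
  rw [integral_add hvi hgi]
  ring

lemma isNDensity_of_growth {p q : ℝ} (hp : 1 < p)
    (hcont : ContinuousOn (Function.uncurry φ) (univ ×ˢ Ioi 0))
    (hφ2 : ∀ x, ∀ t : ℝ, 0 < t → 0 < φ x t ∧ 0 < deriv (fun τ => φ x τ * τ) t)
    (hφ3 : ∀ x, ∀ t : ℝ, t ≠ 0 → p ≤ φ x |t| * |t| ^ 2 / Phi φ x |t| ∧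
      φ x |t| * |t| ^ 2 / Phi φ x |t| ≤ q) (x : EuclideanSpace ℝ (Fin N)) :
    IsNDensity (fun s => φ x s * s) q := by
  have hc : ContinuousOn (fun s => φ x s * s) (Ioi 0) := by
    refine ContinuousOn.mul ?_ continuousOn_id
    exact hcont.comp (f := fun s => (x, s)) (by fun_prop) fun s hs => ⟨mem_univ _, hs⟩
  have hpos : ∀ t, 0 < t → 0 < φ x t * t := fun t ht => mul_pos (hφ2 x t ht).1 ht
  -- If the integral were nonpositive, the quotient would be nonpositive too (division by zero gives
  -- 0), contradicting the lower bound p > 1.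
  have hΦ : ∀ t, 0 < t → 0 < ∫ s in (0 : ℝ)..t, φ x s * s := fun t ht => by
    have h1 := (hφ3 x t ht.ne').1
    rw [Phi, abs_abs, abs_of_pos ht] at h1
    by_contra h2
    have : φ x t * t ^ 2 / (∫ s in (0 : ℝ)..t, φ x s * s) ≤ 0 :=
      div_nonpos_of_nonneg_of_nonpos (mul_nonneg (hφ2 x t ht).1.le (sq_nonneg t)) (not_lt.1 h2)
    linarith
  refine ⟨hc, ?_, hpos, fun t ht => ?_, fun t ht => ?_⟩
  · refine (strictMonoOn_of_deriv_pos (convex_Ioi 0) hc ?_).monotoneOn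
    rw [interior_Ioi]
    exact fun t ht => (hφ2 x t ht).2
  · rcases ht.eq_or_lt with rfl | ht
    · exact IntervalIntegrable.refl
    -- A non-integrable density would have integral 0 by convention, which positivity excludes.
    · by_contra h
      exact (hΦ t ht).ne' (intervalIntegral.integral_undef h)
  · have h1 := (hφ3 x t ht.ne').2
    rw [Phi, abs_abs, abs_of_pos ht, div_le_iff₀ (hΦ t ht)] at h1
    linarith

end MusielakSobolev

/-! ### The pointwise estimate. -/

theorem lemma5p4 (N : ℕ) (hN : 2 ≤ N)
    (φ : EuclideanSpace ℝ (Fin N) → ℝ → ℝ)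
    -- `φ` is continuous and, for fixed `x`, of class `C¹` in `t > 0`
    (hcont : ContinuousOn (Function.uncurry φ) (univ ×ˢ Ioi 0))
    (hφ1 : ∀ x, ContDiffOn ℝ 1 (φ x) (Ioi 0))
    -- positivity and monotonicity
    (hφ2 : ∀ x, ∀ t : ℝ, 0 < t → 0 < φ x t ∧ 0 < deriv (fun τ => φ x τ * τ) t)
    -- growth: `1 < p < N < q < p* = Np / (N - p)` and `p ≤ φ(x,|t|)|t|² / Φ(x,|t|) ≤ q`
    (hφ3 : ∃ p q : ℝ, 1 < p ∧ p < N ∧ (N : ℝ) < q ∧ q < N * p / (N - p) ∧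
      ∀ x, ∀ t : ℝ, t ≠ 0 →
        p ≤ φ x |t| * |t| ^ 2 / MusielakSobolev.Phi φ x |t| ∧
        φ x |t| * |t| ^ 2 / MusielakSobolev.Phi φ x |t| ≤ q)
    -- `Φ` is radial in `x`
    (hφ10 : ∀ x y : EuclideanSpace ℝ (Fin N), ‖x‖ = ‖y‖ → ∀ t : ℝ, 0 < t →
      MusielakSobolev.Phi φ x t = MusielakSobolev.Phi φ y t)
    -- control of the radial derivative `∂ₛ Φ(s, t)`, where `Φ(s, t) = Φ(s e, t)`, `|e| = 1`
    (hφ11 : ∃ κ : ℝ, 0 < κ ∧ κ < 1 / 2 ^ (N + 1) ∧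
      ∀ e : EuclideanSpace ℝ (Fin N), ‖e‖ = 1 → ∀ s : ℝ, 0 < s → ∀ t : ℝ,
        DifferentiableAt ℝ (fun σ : ℝ => MusielakSobolev.Phi φ (σ • e) t) s ∧
        |deriv (fun σ : ℝ => MusielakSobolev.Phi φ (σ • e) t) s| ≤
          κ * MusielakSobolev.Phi φ (s • e) t) :
    ∃ C : ℝ, 0 < C ∧
      ∀ (v : EuclideanSpace ℝ (Fin N) → ℝ)
        (g : EuclideanSpace ℝ (Fin N) → EuclideanSpace ℝ (Fin N)),
        MusielakSobolev.MemW1Phi φ v g → MusielakSobolev.IsRadial v →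
        MeasureTheory.Integrable
          (fun x => MusielakSobolev.Phi φ x |v x| + MusielakSobolev.Phi φ x ‖g x‖) ∧
        ∀ᵐ x, |v x| ≤ MusielakSobolev.PhiInv φ x
          (C / ‖x‖ ^ (N - 1) *
            ∫ y, (MusielakSobolev.Phi φ y |v y| + MusielakSobolev.Phi φ y ‖g y‖)) := by
  obtain ⟨p, q, hp, -, -, -, hφ3⟩ := hφ3
  obtain ⟨κ, hκ, -, hφ11⟩ := hφ11
  have hd := MusielakSobolev.isNDensity_of_growth hp hcont hφ2 hφ3
  have hσ := MusielakSobolev.sphereArea_pos hN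
  -- Here 2^q comes from doubling, e^κ from the shift of the first variable across the shell, and
  -- the sphere area from normalising the weight.
  refine ⟨2 ^ q * Real.exp κ / MusielakSobolev.sphereArea N, by positivity,
    fun v g hv hr => ⟨?_, ?_⟩⟩
  · have h1 := hv.memLPhi.integrable hcont hd
    have h2 := hv.memLPhi_grad.integrable hcont hd
    simp only [abs_norm] at h2
    exact h1.add h2
  · filter_upwards [hv.ae_Phi_le hN hcont hd (Real.exp_pos κ).le
      (fun x z hx hxz hzx t ht =>
        MusielakSobolev.Phi_le_exp_mul_Phi hκ hd hφ10 hφ11 hx hxz hzx ht) hr] with x hx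
    exact MusielakSobolev.le_PhiInv hd (abs_nonneg _) hx
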